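/- Setting. Let $n,d$ be natural numbers and let $I,J,K$ be disjoint sets of size $n$. Let $\hat A$ (indexed by $I\times J$), $\hat B$ (indexed by $J\times K$) and $\hat X$ (indexed by $I\times K$) be $0/1$ matrices with at most $d$ non-zero entries in each row and each column. A triangle is a set $\{i,j,k\}$ with $i\in I$, $j\in J$, $k\in K$ and $\hat A_{ij},\hat B_{jk},\hat X_{ik}\neq 0$; let $\hat{\mathcal T}$ be the set of all triangles. Model (supported low-bandwidth model). There are $3n$ computers, one for each node of $V=I\cup J\cup K$. The matrices $\hat A,\hat B,\hat X$ and the set of triangles to be processed are known to all computers in advance. The values of the input matrices $A,B$ over a semiring $R$, with $A_{ij}=0$ where $\hat A_{ij}=0$ and $B_{jk}=0$ where $\hat B_{jk}=0$, are revealed at run time: $i\in I$ knows row $i$ of $A$, and $j\in J$ knows row $j$ of $B$. In each synchronous round each computer may send one $b$-bit message to one computer and may receive at most one message; local computation and memory are unrestricted. Here $b$ is such that ring elements fit into a message: all entries of $A$ and $B$ and all partial sums $\sum_{j\in s}A_{ij}B_{jk}$ with $s\subseteq J$ lie in a set $D\subseteq R$ that can be encoded injectively in $b$ bits (for example $D=R$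 if $R$ is finite with $|R|\le 2^b$; the standard choice of $b$ is $O(\log n)$). An algorithm processes a set $\mathcal T\subseteq\hat{\mathcal T}$ in $r$ rounds if after $r$ rounds, for all such $A,B$, every computer $i\in I$ holds for each $k\in K$ the value $\sum_{j:\{i,j,k\}\in\mathcal T}A_{ij}B_{jk}$. Lemma. For every constant $C_0$ there is a constant $C$, depending only on $C_0$, such that the following holds for all real $\varepsilon<1$, all $n$, all $d\ge 2$, all $\hat A,\hat B,\hat X$ as above, and all $\mathcal T\subseteq\hat{\mathcal T}$ with $|\mathcal T|\le C_0\,d^{2-\varepsilon}n$: over every semiring $R$ (in particular, every ring) and for all $D$ and $b$ as above, all triangles in $\mathcal T$ can be processed in at most $C\,d^{2-\varepsilon/2}$ rounds in the supported low-bandwidth model. -/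

import Mathlib

universe u

/-- The structure of an instance, known to all computers in advance: three `n × n` indicator
matrices for the entries of `A`, `B` that may be non-zero and for the entries of `X = A * B`
that are of interest. -/
structure Support (n : ℕ) where
  Ahat : Matrix (Fin n) (Fin n) Bool
  Bhat : Matrix (Fin n) (Fin n) Bool
  Xhat : Matrix (Fin n) (Fin n) Bool

/-- At most `d` non-zero entries in each row and in each column. -/
def UniformlySparseMatrix {n : ℕ} (d : ℕ) (M : Matrix (Fin n) (Fin n) Bool) : Prop :=
  (∀ i, (Finset.univ.filter fun j => M i j = true).card ≤ d) ∧
  (∀ j, (Finset.univ.filter fun i => M i j = true).card ≤ d)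

def Support.UniformlySparse {n : ℕ} (S : Support n) (d : ℕ) : Prop :=
  UniformlySparseMatrix d S.Ahat ∧ UniformlySparseMatrix d S.Bhat ∧ UniformlySparseMatrix d S.Xhat

/-- All triangles `{i, j, k}` with `i ∈ I`, `j ∈ J`, `k ∈ K`, written as triples `(i, j, k)`
(the three index sets are disjoint copies of `Fin n`). -/
def Support.triangles {n : ℕ} (S : Support n) : Finset (Fin n × Fin n × Fin n) :=
  Finset.univ.filter fun t =>
    S.Ahat t.1 t.2.1 = true ∧ S.Bhat t.2.1 t.2.2 = true ∧ S.Xhat t.1 t.2.2 = true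

/-- The `3 n` computers `V = I ∪ J ∪ K` of the tripartite setting. -/
abbrev Node (n : ℕ) : Type := Fin n ⊕ Fin n ⊕ Fin n

/-- What each computer knows about the values at the start: `i ∈ I` knows row `i` of `A`, `j ∈ J`
knows row `j` of `B`, and the computers of `K` know nothing (their input is a dummy zero row). -/
def localInput {n : ℕ} {R : Type u} [Zero R] (A B : Matrix (Fin n) (Fin n) R) :
    Node n → (Fin n → R)
  | Sum.inl i => A i
  | Sum.inr (Sum.inl j) => B j
  | Sum.inr (Sum.inr _) => 0

/-- A message of `b` bits. -/
abbrev Message (b : ℕ) : Type := Fin b → Bool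

/-- A deterministic algorithm for the low-bandwidth model with `b`-bit messages, for instances over
`R`. Every computer has a local memory of unrestricted size and unrestricted local computation.
In round `t` every computer sends at most one message to a computer of its choice, and then updates
its memory with the message that it received in this round, if any. An algorithm may be chosen
depending on the support; it sees the values of `A` and `B` only through `init` and the messages. -/
structure Protocol (n b : ℕ) (R : Type u) where
  /-- the number of communication rounds after which the algorithm stops -/
  rounds : ℕ
  Memory : Type u
  init : Node n → (Fin n → R) → Memory
  send : ℕ → Node n → Memory → Option (Node n × Message b)
  receive : ℕ → Node n → Memory → Option (Message b) → Memory
  /-- row `i` of the product matrix, as computed by computer `i ∈ I` from its memory at the end -/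
  output : Fin n → Memory → (Fin n → R)

open Classical in
/-- The message that arrives at `v` if every computer `u` sends `out u`. The choice plays no role
if at most one message is addressed to `v`, which `Protocol.Respects` demands. -/
noncomputable def delivered {V M : Type*} (out : V → Option (V × M)) (v : V) : Option M :=
  if h : ∃ m, ∃ u, out u = some (v, m) then some h.choose else none

namespace Protocol

variable {n b : ℕ} {R : Type u}

/-- The memory of each computer after `t` rounds, on the local inputs `x`. -/
noncomputable def memory (P : Protocol n b R) (x : Node n → (Fin n → R)) :
    ℕ → Node n → P.Memory
  | 0, v => P.init v (x v)
  | t + 1, v => P.receive t v (P.memory x t v)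
      (delivered (fun u => P.send t u (P.memory x t u)) v)

/-- On the local inputs `x`, each computer is sent at most one message in each round. -/
def Respects (P : Protocol n b R) (x : Node n → (Fin n → R)) : Prop :=
  ∀ t < P.rounds, ∀ v u u' : Node n, ∀ m m' : Message b,
    P.send t u (P.memory x t u) = some (v, m) →
    P.send t u' (P.memory x t u') = some (v, m') → u = u'

end Protocol

/-- The elements of `D` can be encoded in messages of `b` bits. -/
def EncodableIn {R : Type u} (D : Set R) (b : ℕ) : Prop :=
  ∃ code : R → Message b, Set.InjOn code D

/-- `A` and `B` are possible inputs for the support `S`: they vanish outside `Ahat` and `Bhat`, and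
their entries and all partial sums `∑ j ∈ s, A i j * B j k` of entries of the product belong to the
set `D` of representable values. If `R` is finite, `D` can be all of `R`; for the integers, say, `D`
can be an interval. -/
structure IsInput {n : ℕ} {R : Type u} [Semiring R] (S : Support n) (D : Set R)
    (A B : Matrix (Fin n) (Fin n) R) : Prop where
  A_zero : ∀ i j, S.Ahat i j = false → A i j = 0
  B_zero : ∀ j k, S.Bhat j k = false → B j k = 0
  A_mem : ∀ i j, A i j ∈ D
  B_mem : ∀ j k, B j k ∈ D
  sum_mem : ∀ i k, ∀ s : Finset (Fin n), ∑ j ∈ s, A i j * B j k ∈ D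

/-- The algorithm processes the set `T` of triangles: for all possible inputs the bandwidth
restriction is respected, and in the end computer `i ∈ I` holds, for every `k`, the sum of
`A i j * B j k` over all `j` with `{i, j, k} ∈ T`. -/
def Protocol.ProcessesTriangles {n b : ℕ} {R : Type u} [Semiring R] (P : Protocol n b R)
    (S : Support n) (D : Set R) (T : Finset (Fin n × Fin n × Fin n)) : Prop :=
  ∀ A B : Matrix (Fin n) (Fin n) R, IsInput S D A B →
    P.Respects (localInput A B) ∧
    ∀ i k, P.output i (P.memory (localInput A B) P.rounds (Sum.inl i)) k =
      ∑ j ∈ Finset.univ.filter (fun j => (i, j, k) ∈ T), A i j * B j k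

/-!
The idea is to split the work at the computers that touch too many triangles. Let
`τ = d ^ (2 - ε / 2)`. Sort the triangles `(i, j, k)` of `T` by `i` and cut the list into blocks of
length `q = O(τ)`; there are at most `n` of them, so each gets a computer of its own, the owner
of its triangles. A node `i` touches at most `d ^ 2` triangles, so these lie in at most
`d ^ 2 / q + 2` blocks (`exists_owner`). Do the same with the list sorted by `j`, which gives each
triangle a second owner. Now route as follows.

* Each `i` sends `A i j` to the owners, in the first sense, of its triangles at `j`.
* Each `j` sends `B j k` to the owners, in the second sense, of its triangles at `k`.
* For each triangle, the second owner sends `B j k` to the first owner, which then knows both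
  factors.
* The first owner adds up its products for each pair `(i, k)` and sends the sum to `i`, which adds
  the sums of all owners.

An owner takes part in at most `q` messages in each phase, and a node of `I` or `J` in at most
`d * (d ^ 2 / q + 2) = O(d ^ 3 / τ + d)`, as its row has at most `d` relevant entries. The latter is
`O(τ)` because `d ^ 3 / τ = d ^ (1 + ε / 2) ≤ τ` for `ε ≤ 1` (`load_le`). Messages of which every
computer sends and receives at most `Δ` take `2 * Δ` rounds, by a greedy edge colouring
(`Attainable.route`).

What a computer knows is expressed without any decoding functions: it knows a quantity if inputs
with the same transcript give the same value (`Attainable`). A sender or the output can then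
evaluate the quantity at any input consistent with the transcript, and knowledge is closed under
local computation.
-/

namespace LowBandwidth

/-! ### Protocols that record their transcript -/

section Model

variable {n b : ℕ} {R : Type u}

/-- A quantity determined by the local inputs of all computers. -/
abbrev Quantity (n : ℕ) (R : Type u) : Type u := (Node n → Fin n → R) → R

/-- The memory of a computer that only records: its local input and what arrived in each round so
far, the latest round first. -/
abbrev Transcript (n b : ℕ) (R : Type u) : Type u := (Fin n → R) × List (Option (Message b))

/-- What a computer sends in each round, as a function of its transcript. -/
abbrev Strategy (n b : ℕ) (R : Type u) : Type u :=
  ℕ → Node n → Transcript n b R → Option (Node n × Message b)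

/-- The transcripts after `t` rounds on the local inputs `x`. -/
noncomputable def transcript (send : Strategy n b R) (x : Node n → Fin n → R) :
    ℕ → Node n → Transcript n b R
  | 0, v => (x v, [])
  | t + 1, v => ((transcript send x t v).1,
      delivered (fun u => send t u (transcript send x t u)) v :: (transcript send x t v).2)

/-- The protocol that follows a strategy for `r` rounds and then computes the output. -/
def Strategy.protocol (send : Strategy n b R) (r : ℕ)
    (output : Fin n → Transcript n b R → Fin n → R) : Protocol n b R where
  rounds := r
  Memory := Transcript n b R
  init := fun _ a => (a, [])
  send := send
  receive := fun _ _ m o => (m.1, o :: m.2)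
  output := output

theorem Strategy.memory_protocol (send : Strategy n b R) (r : ℕ)
    (output : Fin n → Transcript n b R → Fin n → R) (x : Node n → Fin n → R) (t : ℕ) :
    (send.protocol r output).memory x t = transcript send x t := by
  induction t with
  | zero => rfl
  | succ t ih =>
    funext v
    simp only [Protocol.memory, transcript, ih]
    rfl

theorem transcript_congr {send send' : Strategy n b R} {r : ℕ}
    (h : ∀ t < r, send t = send' t) (x : Node n → Fin n → R) :
    ∀ t ≤ r, transcript send x t = transcript send' x t := by
  intro t
  induction t with
  | zero => intro _; rfl
  | succ t ih =>
    intro ht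
    funext v
    simp only [transcript, ih (by omega), h t (by omega)]

theorem delivered_eq_some {V M : Type*} {out : V → Option (V × M)} {u v : V} {m : M}
    (h : out u = some (v, m)) (huniq : ∀ u' m', out u' = some (v, m') → u' = u) :
    delivered out v = some m := by
  have hex : ∃ m, ∃ u, out u = some (v, m) := ⟨m, u, h⟩
  obtain ⟨u', hu'⟩ := hex.choose_spec
  have hu := huniq u' _ hu'
  rw [hu, h] at hu'
  rw [delivered, dif_pos hex]
  simp only [Option.some.injEq, Prod.mk.injEq, true_and] at hu'
  rw [← hu']

/-- Some strategy respects the bandwidth for `r` rounds on the inputs in `inputs`, and after these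
rounds each computer `v` knows the quantities in `F v`. Knowledge is expressed semantically: inputs
with the same transcript at `v` give the same value. It is thus closed under local computation. -/
def Attainable (inputs : Set (Node n → Fin n → R)) (b r : ℕ)
    (F : Node n → Set (Quantity n R)) : Prop :=
  ∃ send : Strategy n b R,
    (∀ x ∈ inputs, ∀ t < r, ∀ v u u' : Node n, ∀ m m' : Message b,
      send t u (transcript send x t u) = some (v, m) →
      send t u' (transcript send x t u') = some (v, m') → u = u') ∧
    ∀ v, ∀ φ ∈ F v, ∀ x ∈ inputs, ∀ y ∈ inputs,
      transcript send x r v = transcript send y r v → φ x = φ y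

variable {inputs : Set (Node n → Fin n → R)} {r : ℕ} {F : Node n → Set (Quantity n R)}

theorem attainable_zero (inputs : Set (Node n → Fin n → R)) (b : ℕ) :
    Attainable inputs b 0 fun v => {φ | ∃ j, φ = fun x => x v j} := by
  refine ⟨fun _ _ _ => none, fun _ _ t ht => absurd ht (Nat.not_lt_zero t), ?_⟩
  rintro v φ ⟨j, rfl⟩ x _ y _ hxy
  exact congrFun (congrArg Prod.fst hxy) j

theorem Attainable.of_determined (h : Attainable inputs b r F) {F' : Node n → Set (Quantity n R)}
    (hF : ∀ v, ∀ φ ∈ F' v, ∀ x ∈ inputs, ∀ y ∈ inputs, (∀ ψ ∈ F v, ψ x = ψ y) → φ x = φ y) :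
    Attainable inputs b r F' := by
  obtain ⟨send, h₁, h₂⟩ := h
  exact ⟨send, h₁, fun v φ hφ x hx y hy hxy =>
    hF v φ hφ x hx y hy fun ψ hψ => h₂ v ψ hψ x hx y hy hxy⟩

open Classical in
/-- One more round, in which the messages form a matching between senders and receivers. -/
theorem Attainable.round (h : Attainable inputs b r F) {D : Set R} (hb : EncodableIn D b)
    {ι : Type*} (s : Set ι) (src dst : ι → Node n) (φ : ι → Quantity n R)
    (hsrc : Set.InjOn src s) (hdst : Set.InjOn dst s)
    (hφ : ∀ i ∈ s, φ i ∈ F (src i)) (hD : ∀ i ∈ s, ∀ x ∈ inputs, φ i x ∈ D) :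
    Attainable inputs b (r + 1) fun v => F v ∪ {ψ | ∃ i ∈ s, dst i = v ∧ φ i = ψ} := by
  obtain ⟨send, h₁, h₂⟩ := h
  obtain ⟨code, hcode⟩ := hb
  -- The sender recovers the value from any input that is consistent with its transcript.
  let send' : Strategy n b R := fun t v m =>
    if t < r then send t v m else
    if h : ∃ i ∈ s, src i = v then
      some (dst h.choose,
        if hx : ∃ x ∈ inputs, transcript send x r v = m then code (φ h.choose hx.choose)
        else fun _ => false)
    else none
  have hlt : ∀ t < r, send t = send' t := by
    intro t ht
    funext v m
    simp [send', ht]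
  have htr := transcript_congr hlt
  have hsend : ∀ i ∈ s, ∀ x ∈ inputs,
      send' r (src i) (transcript send x r (src i)) = some (dst i, code (φ i x)) := by
    intro i hi x hx
    have hex : ∃ j ∈ s, src j = src i := ⟨i, hi, rfl⟩
    have hj : hex.choose = i := hsrc hex.choose_spec.1 hi hex.choose_spec.2
    have hey : ∃ y ∈ inputs, transcript send y r (src i) = transcript send x r (src i) :=
      ⟨x, hx, rfl⟩
    simp only [send', lt_irrefl, if_false, dif_pos hex, dif_pos hey, hj]
    rw [h₂ (src i) (φ i) (hφ i hi) _ hey.choose_spec.1 x hx hey.choose_spec.2]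
  have hsend_inv : ∀ u m v msg, send' r u m = some (v, msg) → ∃ i ∈ s, src i = u ∧ dst i = v := by
    intro u m v msg hu
    simp only [send', lt_irrefl, if_false] at hu
    split_ifs at hu with hex
    all_goals
      obtain ⟨hi, hiu⟩ := hex.choose_spec
      simp only [Option.some.injEq, Prod.mk.injEq] at hu
      exact ⟨_, hi, hiu, hu.1⟩
  refine ⟨send', ?_, ?_⟩
  · intro x hx t ht v u u' m m' hu hu'
    rcases Nat.lt_succ_iff_lt_or_eq.mp ht with ht | rfl
    · rw [← htr x t ht.le, ← hlt t ht] at hu hu'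
      exact h₁ x hx t ht v u u' m m' hu hu'
    · obtain ⟨i, hi, rfl, hiv⟩ := hsend_inv _ _ _ _ hu
      obtain ⟨j, hj, rfl, hjv⟩ := hsend_inv _ _ _ _ hu'
      rw [hdst hi hj (hiv.trans hjv.symm)]
  · intro v ψ hψ x hx y hy hxy
    simp only [transcript, ← htr x r le_rfl, ← htr y r le_rfl, Prod.mk.injEq,
      List.cons.injEq] at hxy
    obtain ⟨hxy₁, hxy₂, hxy₃⟩ := hxy
    rcases hψ with hψ | ⟨i, hi, rfl, rfl⟩
    · exact h₂ v ψ hψ x hx y hy (Prod.ext hxy₁ hxy₃)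
    · have hdel : ∀ z ∈ inputs,
          delivered (fun u => send' r u (transcript send z r u)) (dst i) =
            some (code (φ i z)) := by
        intro z hz
        refine delivered_eq_some (u := src i) (hsend i hi z hz) ?_
        intro u' m' hu'
        obtain ⟨j, hj, rfl, hji⟩ := hsend_inv _ _ _ _ hu'
        rw [hdst hj hi hji]
      rw [hdel x hx, hdel y hy, Option.some.injEq] at hxy₂
      exact hcode (hD i hi x hx) (hD i hi y hy) hxy₂

/-- Messages that are properly coloured with `k` colours are delivered in `k` rounds. -/
theorem Attainable.route_of_coloring (h : Attainable inputs b r F) {D : Set R}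
    (hb : EncodableIn D b) {ι : Type*} (s : Set ι) (src dst : ι → Node n)
    (φ : ι → Quantity n R) (hφ : ∀ i ∈ s, φ i ∈ F (src i))
    (hD : ∀ i ∈ s, ∀ x ∈ inputs, φ i x ∈ D) (c : ι → ℕ)
    (hc : ∀ i ∈ s, ∀ j ∈ s, c i = c j → src i = src j ∨ dst i = dst j → i = j) (k : ℕ) :
    Attainable inputs b (r + k) fun v => F v ∪ {ψ | ∃ i ∈ s, c i < k ∧ dst i = v ∧ φ i = ψ} := by
  induction k with
  | zero => simpa using h
  | succ k ih =>
    refine (ih.round hb {i ∈ s | c i = k} src dst φ ?_ ?_ ?_ ?_).of_determined ?_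
    · exact fun i hi j hj hij => hc i hi.1 j hj.1 (hi.2.trans hj.2.symm) (Or.inl hij)
    · exact fun i hi j hj hij => hc i hi.1 j hj.1 (hi.2.trans hj.2.symm) (Or.inr hij)
    · exact fun i hi => Or.inl (hφ i hi.1)
    · exact fun i hi => hD i hi.1
    · rintro v ψ (hψ | ⟨i, hi, hik, hiv, rfl⟩) x _ y _ hxy
      · exact hxy ψ (Or.inl (Or.inl hψ))
      · rcases Nat.lt_succ_iff_lt_or_eq.mp hik with hik | hik
        · exact hxy _ (Or.inl (Or.inr ⟨i, hi, hik, hiv, rfl⟩))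
        · exact hxy _ (Or.inr ⟨i, ⟨hi, hik⟩, hiv, rfl⟩)

end Model

/-! ### Routing by greedy edge colouring -/

/-- A bipartite multigraph of maximum degree at most `Δ` has a proper edge colouring with `2 * Δ`
colours, as an edge meets at most `2 * (Δ - 1)` others. -/
theorem exists_edge_coloring {ι V W : Type*} [DecidableEq ι] [DecidableEq V] [DecidableEq W]
    (s : Finset ι) (src : ι → V) (dst : ι → W) (Δ : ℕ)
    (hsrc : ∀ v, (s.filter fun i => src i = v).card ≤ Δ)
    (hdst : ∀ w, (s.filter fun i => dst i = w).card ≤ Δ) :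
    ∃ c : ι → ℕ, (∀ i ∈ s, c i < 2 * Δ) ∧
      ∀ i ∈ s, ∀ j ∈ s, c i = c j → src i = src j ∨ dst i = dst j → i = j := by
  induction s using Finset.induction_on with
  | empty => exact ⟨fun _ => 0, by simp, by simp⟩
  | insert a s ha ih =>
    obtain ⟨c, hc₁, hc₂⟩ := ih
      (fun v => (Finset.card_le_card (Finset.filter_subset_filter _
        (Finset.subset_insert a s))).trans (hsrc v))
      (fun v => (Finset.card_le_card (Finset.filter_subset_filter _
        (Finset.subset_insert a s))).trans (hdst v))
    have h₁ := hsrc (src a)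
    have h₂ := hdst (dst a)
    rw [Finset.filter_insert, if_pos rfl, Finset.card_insert_of_notMem (by simp [ha])] at h₁ h₂
    set N := (s.filter fun i => src i = src a) ∪ (s.filter fun i => dst i = dst a) with hN
    have hcard : (N.image c).card < (Finset.range (2 * Δ)).card := by
      have := Finset.card_image_le (s := N) (f := c)
      have := Finset.card_union_le (s.filter fun i => src i = src a)
        (s.filter fun i => dst i = dst a)
      rw [← hN] at this
      rw [Finset.card_range]
      omega
    obtain ⟨e, he, heN⟩ := Finset.exists_mem_notMem_of_card_lt_card hcard
    have hne : ∀ i ∈ s, e = c i → ¬ (src i = src a ∨ dst i = dst a) := by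
      intro i hi hei hia
      refine heN (hei ▸ Finset.mem_image_of_mem c ?_)
      simpa [hN, hi] using hia
    have hs : ∀ i ∈ s, i ≠ a := fun i hi hia => ha (hia ▸ hi)
    refine ⟨Function.update c a e, ?_, ?_⟩
    · intro i hi
      rcases Finset.mem_insert.mp hi with rfl | hi
      · simpa using he
      · rw [Function.update_of_ne (hs i hi)]
        exact hc₁ i hi
    · intro i hi j hj
      rcases Finset.mem_insert.mp hi with rfl | hi' <;>
        rcases Finset.mem_insert.mp hj with rfl | hj'
      · exact fun _ _ => rfl
      · rw [Function.update_self, Function.update_of_ne (hs j hj')]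
        intro h h'
        exact absurd (h'.imp Eq.symm Eq.symm) (hne j hj' h)
      · rw [Function.update_self, Function.update_of_ne (hs i hi')]
        intro h h'
        exact absurd h' (hne i hi' h.symm)
      · rw [Function.update_of_ne (hs i hi'), Function.update_of_ne (hs j hj')]
        exact hc₂ i hi' j hj'

/-- If every computer sends and receives at most `Δ` of the messages, they can be delivered in
`2 * Δ` rounds. -/
theorem Attainable.route {n b r Δ : ℕ} {R : Type u} {inputs : Set (Node n → Fin n → R)}
    {F : Node n → Set (Quantity n R)} (h : Attainable inputs b r F) {D : Set R}
    (hb : EncodableIn D b) {ι : Type*} [DecidableEq ι] (s : Finset ι) (src dst : ι → Node n)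
    (φ : ι → Quantity n R)
    (hsrc : ∀ v, (s.filter fun i => src i = v).card ≤ Δ)
    (hdst : ∀ v, (s.filter fun i => dst i = v).card ≤ Δ)
    (hφ : ∀ i ∈ s, φ i ∈ F (src i)) (hD : ∀ i ∈ s, ∀ x ∈ inputs, φ i x ∈ D) :
    Attainable inputs b (r + 2 * Δ)
      fun v => F v ∪ {ψ | ∃ i ∈ s, dst i = v ∧ φ i = ψ} := by
  obtain ⟨c, hc₁, hc₂⟩ := exists_edge_coloring s src dst Δ hsrc hdst
  refine (h.route_of_coloring hb (s : Set ι) src dst φ hφ hD c hc₂ (2 * Δ)).of_determined ?_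
  rintro v ψ (hψ | ⟨i, hi, hiv, rfl⟩) x _ y _ hxy
  · exact hxy ψ (Or.inl hψ)
  · exact hxy _ (Or.inr ⟨i, hi, hc₁ i hi, hiv, rfl⟩)

/-! ### Distributing the triangles evenly -/

/-- The elements of `T` can be distributed over `n` owners with at most `q` elements each so that
the elements of each fibre of `f` have few owners: list `T` fibre by fibre and cut the list into
blocks of length `q`. -/
theorem exists_owner {α : Type*} [Fintype α] [DecidableEq α] {n q : ℕ} (hq : 0 < q)
    (T : Finset α) (hT : T.card ≤ n * q) (f : α → Fin n) :
    ∃ own : α → Fin n, (∀ p, (T.filter fun t => own t = p).card ≤ q) ∧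
      ∀ i, ((T.filter fun t => f t = i).image own).card ≤
        (T.filter fun t => f t = i).card / q + 2 := by
  let key : α → Fin n ×ₗ Fin (Fintype.card α) := fun t => toLex (f t, Fintype.equivFin α t)
  have hkey : Function.Injective key := by
    intro s t hst
    have := congrArg (fun z => (ofLex z).2) hst
    exact (Fintype.equivFin α).injective this
  let rank : α → ℕ := fun t => (T.filter fun s => key s < key t).card
  have hrank_lt : ∀ s ∈ T, ∀ t, key s < key t → rank s < rank t := by
    intro s hs t hst
    refine Finset.card_lt_card (Finset.ssubset_iff_of_subset ?_ |>.mpr ⟨s, ?_, ?_⟩)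
    · intro u hu
      simp only [Finset.mem_filter] at hu ⊢
      exact ⟨hu.1, hu.2.trans hst⟩
    · simp [hs, hst]
    · simp
  have hrank_inj : Set.InjOn rank T := by
    intro s hs t ht hst
    rcases lt_trichotomy (key s) (key t) with h | h | h
    · exact absurd hst (hrank_lt s hs t h).ne
    · exact hkey h
    · exact absurd hst (hrank_lt t ht s h).ne'
  have hrank_bound : ∀ t ∈ T, rank t < T.card := by
    intro t ht
    refine Finset.card_lt_card (Finset.ssubset_iff_of_subset (Finset.filter_subset _ _) |>.mpr
      ⟨t, ht, by simp⟩)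
  have hdiv : ∀ t ∈ T, rank t / q < n := fun t ht =>
    Nat.div_lt_of_lt_mul (by rw [mul_comm]; exact (hrank_bound t ht).trans_le hT)
  -- Outside of `T` the value is arbitrary.
  let own : α → Fin n := fun t => if h : rank t / q < n then ⟨rank t / q, h⟩ else f t
  have hown : ∀ t ∈ T, (own t : ℕ) = rank t / q := by
    intro t ht
    simp [own, hdiv t ht]
  refine ⟨own, ?_, ?_⟩
  · intro p
    calc (T.filter fun t => own t = p).card
        ≤ (Finset.Ico (p * q) (p * q + q)).card := by
          refine Finset.card_le_card_of_injOn rank ?_ ?_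
          · intro t ht
            simp only [Finset.coe_filter, Set.mem_ofPred_eq] at ht
            have h := hown t ht.1
            rw [ht.2] at h
            have h₁ := Nat.div_add_mod (rank t) q
            have h₂ := Nat.mod_lt (rank t) hq
            rw [← h, mul_comm] at h₁
            simp only [Finset.coe_Ico, Set.mem_Ico]
            omega
          · intro s hs t ht
            simp only [Finset.coe_filter, Set.mem_ofPred_eq] at hs ht
            exact hrank_inj hs.1 ht.1
      _ = q := by simp
  · intro i
    -- The ranks of the fibre over `i` lie in an interval as long as the fibre.
    set a := (T.filter fun s => f s < i).card with ha
    set m := (T.filter fun t => f t = i).card with hm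
    have hint : ∀ t ∈ T, f t = i → a ≤ rank t ∧ rank t < a + m := by
      intro t ht hti
      constructor
      · refine Finset.card_le_card fun s hs => ?_
        simp only [Finset.mem_filter] at hs ⊢
        refine ⟨hs.1, ?_⟩
        rw [Prod.Lex.toLex_lt_toLex]
        exact Or.inl (hti ▸ hs.2)
      · rw [ha, hm, ← Finset.card_union_of_disjoint]
        · refine Finset.card_lt_card (Finset.ssubset_iff_of_subset ?_ |>.mpr ⟨t, ?_, ?_⟩)
          · intro s hs
            simp only [Finset.mem_filter, Finset.mem_union] at hs ⊢
            have h := hs.2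
            rw [Prod.Lex.toLex_lt_toLex] at h
            rcases h with h | h
            · exact Or.inl ⟨hs.1, hti ▸ h⟩
            · exact Or.inr ⟨hs.1, h.1.trans hti⟩
          · simp [ht, hti]
          · simp
        · rw [Finset.disjoint_filter]
          intro s _ hs hs'
          exact hs.ne hs'
    calc ((T.filter fun t => f t = i).image own).card
        ≤ (Finset.Icc (a / q) (a / q + (m / q + 1))).card := by
          refine Finset.card_le_card_of_injOn (fun p => (p : ℕ)) ?_ Fin.val_injective.injOn
          intro p hp
          simp only [Finset.coe_image, Finset.coe_filter, Set.mem_image, Set.mem_ofPred_eq] at hp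
          obtain ⟨t, ⟨ht, hti⟩, rfl⟩ := hp
          obtain ⟨h₁, h₂⟩ := hint t ht hti
          simp only [hown t ht, Finset.coe_Icc, Set.mem_Icc]
          refine ⟨Nat.div_le_div_right h₁, ?_⟩
          rw [← Nat.lt_succ_iff, Nat.div_lt_iff_lt_mul hq]
          have e₁ := Nat.lt_div_mul_add hq (a := a)
          have e₂ := Nat.lt_div_mul_add hq (a := m)
          calc rank t < a + m := h₂
            _ ≤ (a / q * q + q) + (m / q * q + q) := by omega
            _ = _ := by rw [Nat.succ_eq_add_one]; ring
      _ = m / q + 2 := by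
          rw [Nat.card_Icc]
          generalize a / q = u
          generalize m / q = w
          omega

/-- A fibre of `f` meets at most `d` values of `g` and few owners, hence few pairs of these. -/
theorem card_filter_image_owner_le {α β γ δ : Type*} [DecidableEq β] [DecidableEq γ]
    [DecidableEq δ] (T : Finset α) (f : α → β) (g : α → γ) (own : α → δ) (i : β) {d e : ℕ}
    (hg : ((T.filter fun t => f t = i).image g).card ≤ d)
    (hown : ((T.filter fun t => f t = i).image own).card ≤ e) :
    ((T.image fun t => (f t, g t, own t)).filter fun m => m.1 = i).card ≤ d * e := by
  refine le_trans ?_ (Nat.mul_le_mul hg hown)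
  rw [← Finset.card_product]
  refine Finset.card_le_card_of_injOn (fun m => m.2) ?_ ?_
  · intro m hm
    simp only [Finset.coe_filter, Finset.mem_image, Set.mem_ofPred_eq] at hm
    obtain ⟨⟨t, ht, rfl⟩, hi⟩ := hm
    simp only [Finset.coe_product, Set.mem_prod, Finset.mem_coe]
    exact ⟨Finset.mem_image_of_mem _ (by simpa using ⟨ht, hi⟩),
      Finset.mem_image_of_mem _ (by simpa using ⟨ht, hi⟩)⟩
  · intro m hm m' hm' h
    simp only [Finset.coe_filter, Set.mem_ofPred_eq] at hm hm'
    exact Prod.ext (hm.2.trans hm'.2.symm) h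

theorem card_filter_image_eq_owner_le {α β γ δ : Type*} [DecidableEq β] [DecidableEq γ]
    [DecidableEq δ] (T : Finset α) (f : α → β) (g : α → γ) (own : α → δ) (p : δ) {q : ℕ}
    (h : (T.filter fun t => own t = p).card ≤ q) :
    ((T.image fun t => (f t, g t, own t)).filter fun m => m.2.2 = p).card ≤ q := by
  rw [Finset.filter_image]
  exact Finset.card_image_le.trans h

section Sparse

variable {n d : ℕ} {S : Support n} {T : Finset (Fin n × Fin n × Fin n)}

theorem card_triangles_fst_le (hS : S.UniformlySparse d) (hT : T ⊆ S.triangles) (i : Fin n) :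
    (T.filter fun t => t.1 = i).card ≤ d ^ 2 := by
  obtain ⟨hA, _, hX⟩ := hS
  calc (T.filter fun t => t.1 = i).card
      ≤ ((Finset.univ.filter fun j => S.Ahat i j = true) ×ˢ
          (Finset.univ.filter fun k => S.Xhat i k = true)).card := by
        refine Finset.card_le_card_of_injOn (fun t => t.2) ?_ ?_
        · intro t ht
          simp only [Finset.coe_filter, Set.mem_ofPred_eq] at ht
          obtain ⟨ht, rfl⟩ := ht
          have := hT ht
          simp only [Support.triangles, Finset.mem_filter] at this
          simp [this]
        · intro s hs t ht hst
          simp only [Finset.coe_filter, Set.mem_ofPred_eq] at hs ht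
          exact Prod.ext (hs.2.trans ht.2.symm) hst
    _ ≤ d ^ 2 := by
        rw [Finset.card_product, sq]
        exact Nat.mul_le_mul (hA.1 i) (hX.1 i)

theorem card_triangles_snd_le (hS : S.UniformlySparse d) (hT : T ⊆ S.triangles) (j : Fin n) :
    (T.filter fun t => t.2.1 = j).card ≤ d ^ 2 := by
  obtain ⟨hA, hB, _⟩ := hS
  calc (T.filter fun t => t.2.1 = j).card
      ≤ ((Finset.univ.filter fun i => S.Ahat i j = true) ×ˢ
          (Finset.univ.filter fun k => S.Bhat j k = true)).card := by
        refine Finset.card_le_card_of_injOn (fun t => (t.1, t.2.2)) ?_ ?_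
        · intro t ht
          simp only [Finset.coe_filter, Set.mem_ofPred_eq] at ht
          obtain ⟨ht, rfl⟩ := ht
          have := hT ht
          simp only [Support.triangles, Finset.mem_filter] at this
          simp [this]
        · intro s hs t ht hst
          simp only [Finset.coe_filter, Set.mem_ofPred_eq] at hs ht
          simp only [Prod.mk.injEq] at hst
          exact Prod.ext hst.1 (Prod.ext (hs.2.trans ht.2.symm) hst.2)
    _ ≤ d ^ 2 := by
        rw [Finset.card_product, sq]
        exact Nat.mul_le_mul (hA.2 j) (hB.1 j)

theorem card_triangles_le (hS : S.UniformlySparse d) (hT : T ⊆ S.triangles) :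
    T.card ≤ d ^ 2 * n := by
  rw [Finset.card_eq_sum_card_fiberwise (f := fun t => t.1) (t := Finset.univ) (by simp)]
  refine (Finset.sum_le_card_nsmul _ _ _ fun i _ => card_triangles_fst_le hS hT i).trans ?_
  simp [mul_comm]

end Sparse

/-! ### The algorithm -/

theorem card_filter_comp_le {ι α β : Type*} [DecidableEq α] [DecidableEq β] {s : Finset ι}
    {g : ι → α} {e : α → β} (he : Function.Injective e) {Δ : ℕ}
    (h : ∀ a, (s.filter fun m => g m = a).card ≤ Δ) (v : β) :
    (s.filter fun m => e (g m) = v).card ≤ Δ := by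
  by_cases hv : ∃ a, e a = v
  · obtain ⟨a, rfl⟩ := hv
    simpa only [he.eq_iff] using h a
  · rw [Finset.filter_false_of_mem fun m _ hm => hv ⟨_, hm⟩]
    exact Nat.zero_le _

/-- Four routing phases suffice. Each triangle has an owner among the blocks of the list sorted by
its node in `I`, and another one among the blocks of the list sorted by its node in `J`. -/
theorem exists_protocol {n d q : ℕ} (hq : 0 < q) {S : Support n} (hS : S.UniformlySparse d)
    {T : Finset (Fin n × Fin n × Fin n)} (hT : T ⊆ S.triangles) (hcard : T.card ≤ n * q)
    {R : Type u} [Semiring R] {D : Set R} {b : ℕ} (hb : EncodableIn D b) :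
    ∃ P : Protocol n b R, P.rounds = 8 * (q + d * (d ^ 2 / q + 2)) ∧
      P.ProcessesTriangles S D T := by
  obtain ⟨ownI, hI, hI'⟩ := exists_owner hq T hcard fun t => t.1
  obtain ⟨ownJ, hJ, hJ'⟩ := exists_owner hq T hcard fun t => t.2.1
  set Δ := q + d * (d ^ 2 / q + 2) with hΔ
  have hIle : ∀ i, ((T.filter fun t => t.1 = i).image ownI).card ≤ d ^ 2 / q + 2 := fun i =>
    (hI' i).trans (Nat.add_le_add_right
      (Nat.div_le_div_right (card_triangles_fst_le hS hT i)) 2)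
  have hJle : ∀ j, ((T.filter fun t => t.2.1 = j).image ownJ).card ≤ d ^ 2 / q + 2 := fun j =>
    (hJ' j).trans (Nat.add_le_add_right
      (Nat.div_le_div_right (card_triangles_snd_le hS hT j)) 2)
  have hqΔ : q ≤ Δ := Nat.le_add_right _ _
  have hdΔ : d * (d ^ 2 / q + 2) ≤ Δ := Nat.le_add_left _ _
  have htri : ∀ t ∈ T, S.Ahat t.1 t.2.1 = true ∧ S.Bhat t.2.1 t.2.2 = true ∧
      S.Xhat t.1 t.2.2 = true := fun t ht => by
    simpa [Support.triangles] using hT ht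
  have hinl : Function.Injective (Sum.inl : Fin n → Node n) := Sum.inl_injective
  have hinr : Function.Injective (fun j : Fin n => (Sum.inr (Sum.inl j) : Node n)) :=
    Sum.inr_injective.comp Sum.inl_injective
  let inputs : Set (Node n → Fin n → R) := {x | ∃ A B, IsInput S D A B ∧ x = localInput A B}
  -- Row `i` of `A` goes to the owners of the triangles at `i`.
  have step₁ := (attainable_zero inputs b).route hb (Δ := Δ)
    (T.image fun t => (t.1, t.2.1, ownI t)) (fun m => Sum.inl m.1) (fun m => Sum.inl m.2.2)
    (fun m x => x (Sum.inl m.1) m.2.1)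
    (card_filter_comp_le hinl fun i => (card_filter_image_owner_le T _ _ _ i
      ((Finset.card_le_card (by
        intro j hj
        simp only [Finset.mem_image, Finset.mem_filter] at hj
        obtain ⟨t, ⟨ht, rfl⟩, rfl⟩ := hj
        simp [htri t ht])).trans (hS.1.1 i)) (hIle i)).trans hdΔ)
    (card_filter_comp_le hinl fun p =>
      (card_filter_image_eq_owner_le T (fun t => t.1) (fun t => t.2.1) _ p (hI p)).trans hqΔ)
    (fun m _ => ⟨m.2.1, rfl⟩)
    (by
      rintro m _ _ ⟨A, B, h, rfl⟩
      exact h.A_mem _ _)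
  -- Row `j` of `B` goes to the owners of the triangles at `j`.
  have step₂ := step₁.route hb (Δ := Δ)
    (T.image fun t => (t.2.1, t.2.2, ownJ t)) (fun m => Sum.inr (Sum.inl m.1))
    (fun m => Sum.inl m.2.2) (fun m x => x (Sum.inr (Sum.inl m.1)) m.2.1)
    (card_filter_comp_le hinr fun j => (card_filter_image_owner_le T _ _ _ j
      ((Finset.card_le_card (by
        intro k hk
        simp only [Finset.mem_image, Finset.mem_filter] at hk
        obtain ⟨t, ⟨ht, rfl⟩, rfl⟩ := hk
        simp [htri t ht])).trans (hS.2.1.1 j)) (hJle j)).trans hdΔ)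
    (card_filter_comp_le hinl fun p =>
      (card_filter_image_eq_owner_le T (fun t => t.2.1) (fun t => t.2.2) _ p (hJ p)).trans hqΔ)
    (fun m _ => Or.inl ⟨m.2.1, rfl⟩)
    (by
      rintro m _ _ ⟨A, B, h, rfl⟩
      exact h.B_mem _ _)
  -- For each triangle, the entry of `B` goes from the one owner to the other.
  have step₃ := step₂.route hb (Δ := Δ) T (fun t => Sum.inl (ownJ t)) (fun t => Sum.inl (ownI t))
    (fun t x => x (Sum.inr (Sum.inl t.2.1)) t.2.2)
    (card_filter_comp_le hinl fun p => (hJ p).trans hqΔ)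
    (card_filter_comp_le hinl fun p => (hI p).trans hqΔ)
    (fun t ht => Or.inr ⟨_, Finset.mem_image_of_mem _ ht, rfl, rfl⟩)
    (by
      rintro m _ _ ⟨A, B, h, rfl⟩
      exact h.B_mem _ _)
  let part : Fin n × Fin n × Fin n → Quantity n R := fun m x =>
    ∑ j ∈ Finset.univ.filter (fun j => (m.1, j, m.2.1) ∈ T ∧ ownI (m.1, j, m.2.1) = m.2.2),
      x (Sum.inl m.1) j * x (Sum.inr (Sum.inl j)) m.2.1
  have known₃ := step₃.of_determined
    (F' := fun v => {ψ | ∃ m, Sum.inl m.2.2 = v ∧ part m = ψ}) (by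
      rintro v ψ ⟨⟨i, k, p⟩, rfl, rfl⟩ x _ y _ hxy
      refine Finset.sum_congr rfl fun j hj => ?_
      simp only [Finset.mem_filter, Finset.mem_univ, true_and] at hj
      obtain ⟨ht, rfl⟩ := hj
      have hA := hxy (fun x => x (Sum.inl i) j)
        (Or.inl (Or.inl (Or.inr ⟨_, Finset.mem_image_of_mem _ ht, rfl, rfl⟩)))
      have hB := hxy (fun x => x (Sum.inr (Sum.inl j)) k) (Or.inr ⟨_, ht, rfl, rfl⟩)
      exact congrArg₂ (· * ·) hA hB)
  -- The owners return their parts of the sums.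
  have step₄ := known₃.route hb (Δ := Δ)
    (T.image fun t => (t.1, t.2.2, ownI t)) (fun m => Sum.inl m.2.2) (fun m => Sum.inl m.1) part
    (card_filter_comp_le hinl fun p =>
      (card_filter_image_eq_owner_le T (fun t => t.1) (fun t => t.2.2) _ p (hI p)).trans hqΔ)
    (card_filter_comp_le hinl fun i => (card_filter_image_owner_le T _ _ _ i
      ((Finset.card_le_card (by
        intro k hk
        simp only [Finset.mem_image, Finset.mem_filter] at hk
        obtain ⟨t, ⟨ht, rfl⟩, rfl⟩ := hk
        simp [htri t ht])).trans (hS.2.2.1 i)) (hIle i)).trans hdΔ)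
    (fun m _ => ⟨m, rfl, rfl⟩)
    (by
      rintro m _ _ ⟨A, B, h, rfl⟩
      exact h.sum_mem _ _ _)
  let total : Fin n → Fin n → Quantity n R := fun i k x =>
    ∑ j ∈ Finset.univ.filter (fun j => (i, j, k) ∈ T), x (Sum.inl i) j * x (Sum.inr (Sum.inl j)) k
  have htotal : ∀ i k x, total i k x = ∑ p, part (i, k, p) x := by
    intro i k x
    simp only [total, part]
    rw [← Finset.sum_fiberwise _ (fun j => ownI (i, j, k))]
    simp only [Finset.filter_filter]
  have known₄ := step₄.of_determined
    (F' := fun v => {ψ | ∃ i k, Sum.inl i = v ∧ total i k = ψ}) (by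
      rintro v ψ ⟨i, k, rfl, rfl⟩ x _ y _ hxy
      rw [htotal, htotal]
      refine Finset.sum_congr rfl fun p _ => ?_
      by_cases hp : ∃ j, (i, j, k) ∈ T ∧ ownI (i, j, k) = p
      · obtain ⟨j, ht, rfl⟩ := hp
        exact hxy _ (Or.inr ⟨_, Finset.mem_image_of_mem _ ht, rfl, rfl⟩)
      · -- No message is sent for an empty sum.
        simp only [part]
        rw [Finset.filter_false_of_mem fun j _ hj => hp ⟨j, hj⟩, Finset.sum_empty,
          Finset.sum_empty])
  obtain ⟨send, h₁, h₂⟩ := known₄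
  classical
  refine ⟨send.protocol (0 + 2 * Δ + 2 * Δ + 2 * Δ + 2 * Δ) fun i m k =>
    if h : ∃ x ∈ inputs, transcript send x (0 + 2 * Δ + 2 * Δ + 2 * Δ + 2 * Δ) (Sum.inl i) = m
    then total i k h.choose else 0, ?_, ?_⟩
  · simp only [Strategy.protocol]
    ring
  · intro A B hAB
    have hx : localInput A B ∈ inputs := ⟨A, B, hAB, rfl⟩
    constructor
    · intro t ht v u u' m m' hu hu'
      rw [Strategy.memory_protocol] at hu hu'
      exact h₁ _ hx t ht v u u' m m' hu hu'
    · intro i k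
      rw [Strategy.memory_protocol]
      have hex : ∃ x ∈ inputs, transcript send x (0 + 2 * Δ + 2 * Δ + 2 * Δ + 2 * Δ) (Sum.inl i) =
        transcript send (localInput A B) (0 + 2 * Δ + 2 * Δ + 2 * Δ + 2 * Δ) (Sum.inl i) :=
        ⟨_, hx, rfl⟩
      simp only [Strategy.protocol]
      rw [dif_pos hex]
      exact h₂ _ _ ⟨i, k, rfl, rfl⟩ _ hex.choose_spec.1 _ hx hex.choose_spec.2

/-! ### The choice of the block length -/

/-- The triangles fit into `n` blocks of length `max C₀ 1 * d ^ (2 - ε / 2)`. For `ε ≥ 0` this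
follows from the bound `C₀ * d ^ (2 - ε) * n` on their number, and for `ε ≤ 0` from `d ^ 2 * n`. -/
theorem card_le_mul_rpow {C₀ ε : ℝ} {n d c : ℕ} (hd : 1 ≤ d)
    (h₁ : (c : ℝ) ≤ C₀ * (d : ℝ) ^ (2 - ε) * n) (h₂ : c ≤ d ^ 2 * n) :
    (c : ℝ) ≤ n * (max C₀ 1 * (d : ℝ) ^ (2 - ε / 2)) := by
  have hd' : (1 : ℝ) ≤ d := by exact_mod_cast hd
  have hn : (0 : ℝ) ≤ n := n.cast_nonneg
  have hM : (1 : ℝ) ≤ max C₀ 1 := le_max_right _ _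
  rcases le_total 0 ε with hε | hε
  · have hpow : (d : ℝ) ^ (2 - ε) ≤ (d : ℝ) ^ (2 - ε / 2) :=
      Real.rpow_le_rpow_of_exponent_le hd' (by linarith)
    calc (c : ℝ) ≤ C₀ * (d : ℝ) ^ (2 - ε) * n := h₁
      _ ≤ max C₀ 1 * (d : ℝ) ^ (2 - ε / 2) * n := by
        gcongr
        exact le_max_left _ _
      _ = _ := by ring
  · have hpow : (d : ℝ) ^ (2 : ℝ) ≤ (d : ℝ) ^ (2 - ε / 2) :=
      Real.rpow_le_rpow_of_exponent_le hd' (by linarith)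
    calc (c : ℝ) ≤ (d : ℝ) ^ (2 : ℝ) * n := by
          rw [Real.rpow_two]
          exact_mod_cast h₂
      _ ≤ (max C₀ 1 * (d : ℝ) ^ (2 - ε / 2)) * n := by
        gcongr
        exact hpow.trans (le_mul_of_one_le_left (by positivity) hM)
      _ = _ := by ring

/-- Sending a row to all owners of the triangles at a node is affordable: `d ^ 3 / d ^ (2 - ε / 2)`
is `d ^ (1 + ε / 2)`, and `1 + ε / 2 ≤ 2 - ε / 2` is the condition `ε ≤ 1`. -/
theorem load_le {ε τ : ℝ} (hε : ε < 1) {d q : ℕ} (hd : 1 ≤ d)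
    (hτ : τ = (d : ℝ) ^ (2 - ε / 2)) (hq : τ ≤ q) :
    (d : ℝ) * ((d ^ 2 / q : ℕ) + 2) ≤ 3 * τ := by
  have hd' : (1 : ℝ) ≤ d := by exact_mod_cast hd
  have hd₀ : (0 : ℝ) < d := by linarith
  have hτ₀ : 0 < τ := hτ ▸ Real.rpow_pos_of_pos hd₀ _
  have hdτ : (d : ℝ) ≤ τ := by
    calc (d : ℝ) = (d : ℝ) ^ (1 : ℝ) := (Real.rpow_one _).symm
      _ ≤ τ := hτ ▸ Real.rpow_le_rpow_of_exponent_le hd' (by linarith)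
  have hcube : (d : ℝ) ^ 3 ≤ τ * τ := by
    calc (d : ℝ) ^ 3 = (d : ℝ) ^ (3 : ℝ) := by norm_cast
      _ ≤ (d : ℝ) ^ (2 - ε / 2 + (2 - ε / 2)) :=
        Real.rpow_le_rpow_of_exponent_le hd' (by linarith)
      _ = τ * τ := by rw [Real.rpow_add hd₀, hτ]
  have hdiv : ((d ^ 2 / q : ℕ) : ℝ) ≤ (d : ℝ) ^ 2 / τ := by
    calc ((d ^ 2 / q : ℕ) : ℝ) ≤ ((d ^ 2 : ℕ) : ℝ) / q := Nat.cast_div_le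
      _ ≤ (d : ℝ) ^ 2 / τ := by
        push_cast
        gcongr
  have hmul : (d : ℝ) * ((d : ℝ) ^ 2 / τ) ≤ τ := by
    rw [← mul_div_assoc, div_le_iff₀ hτ₀]
    linarith
  have := mul_le_mul_of_nonneg_left hdiv hd₀.le
  linarith

end LowBandwidth

theorem mainTheorem5 (C₀ : ℝ) :
    ∃ C : ℝ, ∀ (ε : ℝ), ε < 1 → ∀ (n d : ℕ), 2 ≤ d →
      ∀ (S : Support n), S.UniformlySparse d →
      ∀ (T : Finset (Fin n × Fin n × Fin n)), T ⊆ S.triangles →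
        (T.card : ℝ) ≤ C₀ * (d : ℝ) ^ (2 - ε) * (n : ℝ) →
      ∀ (R : Type u) [Semiring R] (D : Set R) (b : ℕ), EncodableIn D b →
        ∃ P : Protocol n b R,
          (P.rounds : ℝ) ≤ C * (d : ℝ) ^ (2 - ε / 2) ∧ P.ProcessesTriangles S D T := by
  refine ⟨8 * (max C₀ 1 + 4), fun ε hε n d hd S hS T hT hcard R _ D b hb => ?_⟩
  have hd₁ : 1 ≤ d := by omega
  have hd' : (1 : ℝ) ≤ d := by exact_mod_cast hd₁
  set τ := (d : ℝ) ^ (2 - ε / 2) with hτ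
  have hτ₁ : 1 ≤ τ := Real.one_le_rpow hd' (by linarith)
  have hM : 1 ≤ max C₀ 1 := le_max_right _ _
  set q := ⌈max C₀ 1 * τ⌉₊ with hq
  have hMτ : max C₀ 1 * τ ≤ q := Nat.le_ceil _
  have hqlt : (q : ℝ) < max C₀ 1 * τ + 1 := Nat.ceil_lt_add_one (by positivity)
  have hτq : τ ≤ q := (le_mul_of_one_le_left (by linarith) hM).trans hMτ
  have hq₀ : 0 < q := by
    have : (0 : ℝ) < q := by linarith
    exact_mod_cast this
  have hTq : T.card ≤ n * q := by
    have h := LowBandwidth.card_le_mul_rpow hd₁ hcard (LowBandwidth.card_triangles_le hS hT)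
    have h' : (T.card : ℝ) ≤ n * q := h.trans (by gcongr)
    exact_mod_cast h'
  obtain ⟨P, hP, hproc⟩ := LowBandwidth.exists_protocol hq₀ hS hT hTq hb
  refine ⟨P, ?_, hproc⟩
  have h := LowBandwidth.load_le hε hd₁ hτ hτq
  rw [hP]
  push_cast at h ⊢
  linarith
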